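/- Let $S$ be a numerical semigroup, i.e. a subsemigroup $S$ of $(\mathbb{N},+)$, where $\mathbb{N}=\{0,1,2,\dots\}$, such that $\mathbb{N}\setminus S$ is finite. Let $\mathcal{P}(S)$ be the semigroup of all finite nonempty subsets of $S$ under the setwise addition $X+Y=\{x+y : x\in X,\ y\in Y\}$, and for $X\in\mathcal{P}(S)$ let $\alpha(X)$ and $\beta(X)$ denote the minimum and the maximum of $X$. (i) If $S=\{l\in\mathbb{N} : l\ge k\}$ for some $k\in\mathbb{N}$, then the map $$\sigma : X\mapsto \beta(X)-X+\alpha(X)=\{\beta(X)-x+\alpha(X) : x\in X\}$$ is an automorphism of $\mathcal{P}(S)$ with $\sigma\circ\sigma=\mathrm{id}$ and $\sigma\neq\mathrm{id}$, and it is the only automorphism of $\mathcal{P}(S)$ other than the identity. (ii) If $S$ is not of the form $\{l\in\mathbb{N} : l\ge k\}$ with $k\in\mathbb{N}$, then the identity is the only automorphism of $\mathcal{P}(S)$. -/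

import Mathlib

open scoped Pointwise

/-- A subsemigroup `S` of `(ℕ, +)` is a numerical semigroup if `ℕ \ S` is finite. -/
def IsNumericalSemigroup (S : AddSubsemigroup ℕ) : Prop :=
  ((S : Set ℕ)ᶜ).Finite

/-- The carrier of the power semigroup `P(S)`: the finite nonempty subsets of `S`. -/
def PowerSemigroup (S : AddSubsemigroup ℕ) : Type :=
  {X : Finset ℕ // X.Nonempty ∧ ∀ x ∈ X, x ∈ S}

namespace PowerSemigroup

/-- The underlying finite set of natural numbers. -/
def toFinset {S : AddSubsemigroup ℕ} (X : PowerSemigroup S) : Finset ℕ := X.1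

/-- `P(S)` with the setwise addition `X + Y = {x + y : x ∈ X, y ∈ Y}`
(the pointwise sum of finsets). -/
instance instAddCommSemigroup (S : AddSubsemigroup ℕ) : AddCommSemigroup (PowerSemigroup S) where
  add X Y := ⟨X.1 + Y.1, X.2.1.add Y.2.1, by
    intro z hz
    obtain ⟨x, hx, y, hy, rfl⟩ := Finset.mem_add.1 hz
    exact S.add_mem (X.2.2 x hx) (Y.2.2 y hy)⟩
  add_assoc X Y Z := Subtype.ext (add_assoc X.1 Y.1 Z.1)
  add_comm X Y := Subtype.ext (add_comm X.1 Y.1)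

/-- `α(X)`, the minimum of `X`. -/
def min {S : AddSubsemigroup ℕ} (X : PowerSemigroup S) : ℕ := X.1.min' X.2.1

/-- `β(X)`, the maximum of `X`. -/
def max {S : AddSubsemigroup ℕ} (X : PowerSemigroup S) : ℕ := X.1.max' X.2.1

/-- The set `β(X) - X + α(X) = {β(X) - x + α(X) : x ∈ X}`. The subtraction of natural numbers
does not truncate here, because `x ≤ β(X)` for `x ∈ X`. -/
def reflection {S : AddSubsemigroup ℕ} (X : PowerSemigroup S) : Finset ℕ :=
  X.toFinset.image fun x => X.max - x + X.min

end PowerSemigroup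

/-! Cancellable elements of `P(S)` are singletons, so an automorphism permutes singletons; beyond
the conductor this action is linear, and invertibility and positivity make it the identity
(`map_single`). Absorbing `X` into a long interval shows that the minimum and maximum of the image
of `X` depend linearly on those of `X`, and the same kind of argument shows that both are preserved
(`min_map_and_max_map`). Hence the automorphism commutes with translations and induces an
automorphism `G` of the finite sets containing `0` that preserves the maximum.

Such a `G` fixes the intervals, the pairs `{0, n}` and the intervals `[0, 2q]` without their
midpoint. Inclusion can be tested by sums of the first and last kind, so `G` is monotone (`mono`). A
set with maximum `d` is determined by the triples `{0, a, d}` inside it, and each triple is fixed or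
reflected (`map_triple`). If `{0, 1, 3}` is fixed, all triples are, and `G` is the identity;
otherwise this applies to `G` composed with the reflection. Finally, the reflection preserves `P(S)`
only if `S` has no gap above its least element. -/

/-- The finite sets of natural numbers with minimum `0` and maximum `d`. -/
def AnchoredSets (d : ℕ) : Set (Finset ℕ) :=
  {X | 0 ∈ X ∧ d ∈ X ∧ ∀ x ∈ X, x ≤ d}

/-- Mutually inverse additive maps on the finite sets of natural numbers containing `0`
which preserve the maximum. -/
structure IsAnchoredAut (G H : Finset ℕ → Finset ℕ) : Prop where
  mapsTo : ∀ {d X}, X ∈ AnchoredSets d → G X ∈ AnchoredSets d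
  mapsTo_inv : ∀ {d X}, X ∈ AnchoredSets d → H X ∈ AnchoredSets d
  left_inv : ∀ {d X}, X ∈ AnchoredSets d → H (G X) = X
  right_inv : ∀ {d X}, X ∈ AnchoredSets d → G (H X) = X
  map_add : ∀ {d e X Y}, X ∈ AnchoredSets d → Y ∈ AnchoredSets e → G (X + Y) = G X + G Y

theorem add_mem_anchoredSets {d e : ℕ} {X Y : Finset ℕ} (hX : X ∈ AnchoredSets d)
    (hY : Y ∈ AnchoredSets e) : X + Y ∈ AnchoredSets (d + e) := by
  refine ⟨Finset.mem_add.2 ⟨0, hX.1, 0, hY.1, rfl⟩, Finset.add_mem_add hX.2.1 hY.2.1, ?_⟩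
  intro z hz
  obtain ⟨x, hx, y, hy, rfl⟩ := Finset.mem_add.1 hz
  exact add_le_add (hX.2.2 x hx) (hY.2.2 y hy)

theorem range_mem_anchoredSets (n : ℕ) : Finset.range (n + 1) ∈ AnchoredSets n := by
  refine ⟨by simp, by simp, fun x hx => ?_⟩
  have := Finset.mem_range.1 hx
  omega

theorem pair_mem_anchoredSets (n : ℕ) : ({0, n} : Finset ℕ) ∈ AnchoredSets n := by
  simp [AnchoredSets]

theorem triple_mem_anchoredSets {a d : ℕ} (h : a ≤ d) :
    ({0, a, d} : Finset ℕ) ∈ AnchoredSets d := by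
  simp [AnchoredSets, h]

theorem mem_pair_add {n z : ℕ} {X : Finset ℕ} :
    z ∈ X + {0, n} ↔ z ∈ X ∨ ∃ x ∈ X, x + n = z := by
  rw [Finset.mem_add]
  constructor
  · rintro ⟨x, hx, y, hy, rfl⟩
    rcases (by simpa using hy : y = 0 ∨ y = n) with rfl | rfl
    · exact Or.inl (by simpa using hx)
    · exact Or.inr ⟨x, hx, rfl⟩
  · rintro (h | ⟨x, hx, rfl⟩)
    · exact ⟨z, h, 0, by simp, by simp⟩
    · exact ⟨x, hx, n, by simp, rfl⟩

theorem mem_triple_add_pair {a d n z : ℕ} :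
    z ∈ ({0, a, d} + {0, n} : Finset ℕ) ↔
      z = 0 ∨ z = a ∨ z = d ∨ z = n ∨ z = a + n ∨ z = d + n := by
  rw [mem_pair_add]
  simp only [Finset.mem_insert, Finset.mem_singleton, exists_eq_or_imp, exists_eq_left]
  omega

/-! ### Punctured intervals as tests for inclusion -/

/-- The interval `[0, 2q - d]` with the points of `q - Y` removed. -/
def punctured (q d : ℕ) (Y : Finset ℕ) : Finset ℕ :=
  (Finset.range (2 * q - d + 1)).filter fun z => ∀ y ∈ Y, z + y ≠ q

theorem mem_punctured {q d z : ℕ} {Y : Finset ℕ} :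
    z ∈ punctured q d Y ↔ z ≤ 2 * q - d ∧ ∀ y ∈ Y, z + y ≠ q := by
  simp [punctured]

theorem punctured_mem_anchoredSets {q d : ℕ} {Y : Finset ℕ} (hq : 2 * d < q)
    (hY : Y ∈ AnchoredSets d) : punctured q d Y ∈ AnchoredSets (2 * q - d) := by
  refine ⟨mem_punctured.2 ⟨by omega, fun y hy => ?_⟩,
    mem_punctured.2 ⟨le_rfl, fun y hy => ?_⟩, fun x hx => (mem_punctured.1 hx).1⟩ <;>
  · have := hY.2.2 y hy
    omega

/-- Either `r = 0 + r` or `r = d + (r - d)` works: the holes lie in `[q - d, q]`, and since `2 * d <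
q` both decompositions can fail only at `r = q`. -/
theorem mem_add_punctured {q d r : ℕ} {X Y : Finset ℕ} (hq : 2 * d < q)
    (hX : X ∈ AnchoredSets d) (hY : Y ∈ AnchoredSets d) (hr : r ≤ 2 * q) (hrq : r ≠ q) :
    r ∈ X + punctured q d Y := by
  by_contra h
  have h0 : r ∉ punctured q d Y := fun h' => h (Finset.mem_add.2 ⟨0, hX.1, r, h', by simp⟩)
  have hd : d ≤ r → r - d ∉ punctured q d Y := fun hdr h' =>
    h (Finset.mem_add.2 ⟨d, hX.2.1, r - d, h', by omega⟩)
  simp only [mem_punctured, not_and, not_forall, not_not] at h0 hd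
  by_cases hr' : r ≤ 2 * q - d
  · obtain ⟨y, hy, hyq⟩ := h0 hr'
    have := hY.2.2 y hy
    obtain ⟨y', hy', hyq'⟩ := hd (by omega) (by omega)
    have := hY.2.2 y' hy'
    omega
  · obtain ⟨y', hy', hyq'⟩ := hd (by omega) (by omega)
    have := hY.2.2 y' hy'
    omega

theorem mem_add_punctured_self {q d : ℕ} {X Y : Finset ℕ} (hq : 2 * d < q)
    (hX : X ∈ AnchoredSets d) :
    q ∈ X + punctured q d Y ↔ ¬ X ⊆ Y := by
  rw [Finset.mem_add, Finset.not_subset]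
  constructor
  · rintro ⟨x, hx, z, hz, h⟩
    exact ⟨x, hx, fun hxY => (mem_punctured.1 hz).2 x hxY (by omega)⟩
  · rintro ⟨x, hx, hxY⟩
    have := hX.2.2 x hx
    refine ⟨x, hx, q - x, mem_punctured.2 ⟨by omega, fun y hy h => hxY ?_⟩, by omega⟩
    rwa [show x = y by omega]

/-! ### Rigidity of automorphisms of anchored sets -/

namespace IsAnchoredAut

variable {G H : Finset ℕ → Finset ℕ}

theorem symm (h : IsAnchoredAut G H) : IsAnchoredAut H G where
  mapsTo := h.mapsTo_inv
  mapsTo_inv := h.mapsTo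
  left_inv := h.right_inv
  right_inv := h.left_inv
  map_add {d e X Y} hX hY := by
    have hX' := h.mapsTo_inv hX
    have hY' := h.mapsTo_inv hY
    rw [← h.left_inv (add_mem_anchoredSets hX' hY'), h.map_add hX' hY', h.right_inv hX,
      h.right_inv hY]

theorem inj (h : IsAnchoredAut G H) {d e : ℕ} {X Y : Finset ℕ} (hX : X ∈ AnchoredSets d)
    (hY : Y ∈ AnchoredSets e) (hXY : G X = G Y) : X = Y := by
  rw [← h.left_inv hX, hXY, h.left_inv hY]

theorem map_range (h : IsAnchoredAut G H) (n : ℕ) :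
    G (Finset.range (n + 1)) = Finset.range (n + 1) := by
  induction n with
  | zero =>
    obtain ⟨h1, -, h3⟩ := h.mapsTo (range_mem_anchoredSets 0)
    ext x
    simp only [Finset.mem_range]
    constructor
    · intro hx
      have := h3 x hx
      omega
    · intro hx
      rwa [show x = 0 by omega]
  | succ n ih =>
    have h1 : G (Finset.range 2) = Finset.range 2 := by
      obtain ⟨h1, h2, h3⟩ := h.mapsTo (range_mem_anchoredSets 1)
      ext x
      simp only [Finset.mem_range]
      constructor
      · intro hx
        have := h3 x hx
        omega
      · intro hx
        rcases (by omega : x = 0 ∨ x = 1) with rfl | rfl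
        · exact h1
        · exact h2
    have key : Finset.range (n + 1 + 1) = Finset.range (n + 1) + Finset.range 2 := by
      ext x
      simp only [Finset.mem_range, Finset.mem_add]
      constructor
      · intro hx
        rcases Nat.eq_zero_or_pos x with rfl | hpos
        · exact ⟨0, by omega, 0, by omega, rfl⟩
        · exact ⟨x - 1, by omega, 1, by omega, by omega⟩
      · rintro ⟨a, ha, b, hb, rfl⟩
        omega
    rw [key, h.map_add (range_mem_anchoredSets n) (range_mem_anchoredSets 1), ih, h1]

theorem map_pair (h : IsAnchoredAut G H) (n : ℕ) : G {0, n} = {0, n} := by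
  obtain ⟨h0, hn, hle⟩ := h.mapsTo (pair_mem_anchoredSets n)
  by_contra hne
  have : ∃ x ∈ G {0, n}, x ≠ 0 ∧ x ≠ n := by
    by_contra! hcon
    apply hne
    ext x
    simp only [Finset.mem_insert, Finset.mem_singleton]
    constructor
    · intro hx
      by_contra hx'
      exact hx' (or_iff_not_imp_left.2 (hcon x hx))
    · rintro (rfl | rfl) <;> assumption
  obtain ⟨x, hx, hx0, hxn⟩ := this
  have hxle := hle x hx
  obtain ⟨m, rfl⟩ : ∃ m, n = m + 2 := ⟨n - 2, by omega⟩
  -- An interior point `x` of the image fills the only gap, `m + 1`, left by `{0, m + 2} + [0, m]`.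
  have hfull : G {0, m + 2} + Finset.range (m + 1) = Finset.range (m + 2 + m + 1) := by
    ext z
    simp only [Finset.mem_add, Finset.mem_range]
    constructor
    · rintro ⟨a, ha, b, hb, rfl⟩
      have := hle a ha
      omega
    · intro hz
      rcases (by omega : z < m + 1 ∨ z = m + 1 ∨ m + 1 < z) with hz' | hz' | hz'
      · exact ⟨0, h0, z, hz', by omega⟩
      · exact ⟨x, hx, z - x, by omega, by omega⟩
      · exact ⟨m + 2, hn, z - (m + 2), by omega, by omega⟩
  have hp := pair_mem_anchoredSets (m + 2)
  have hr := range_mem_anchoredSets m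
  have heq := h.inj (add_mem_anchoredSets hp hr) (range_mem_anchoredSets (m + 2 + m))
    (by rw [h.map_add hp hr, h.map_range, hfull, h.map_range])
  have hmem : m + 1 ∈ ({0, m + 2} + Finset.range (m + 1) : Finset ℕ) := by
    rw [heq, Finset.mem_range]
    omega
  rw [add_comm, mem_pair_add] at hmem
  simp only [Finset.mem_range] at hmem
  rcases hmem with h' | ⟨y, hy, h'⟩ <;> omega

theorem map_erase (h : IsAnchoredAut G H) {q : ℕ} (hq : 0 < q) :
    G ((Finset.range (2 * q + 1)).erase q) = (Finset.range (2 * q + 1)).erase q := by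
  obtain ⟨m, rfl⟩ : ∃ m, q = m + 1 := ⟨q - 1, by omega⟩
  have key : (Finset.range (2 * (m + 1) + 1)).erase (m + 1)
      = Finset.range (m + 1) + {0, m + 2} := by
    ext z
    simp only [mem_pair_add, Finset.mem_erase, Finset.mem_range]
    constructor
    · intro hz
      by_cases hz' : z < m + 1
      · exact Or.inl hz'
      · exact Or.inr ⟨z - (m + 2), by omega, by omega⟩
    · rintro (hz | ⟨x, hx, rfl⟩) <;> omega
  rw [key, h.map_add (range_mem_anchoredSets m) (pair_mem_anchoredSets _), h.map_range,
    h.map_pair]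

/-- With `Z` punctured along `G Y`, the sum `W + Z` is `[0, 2q]`, except that `q` is missing exactly
when `W ⊆ G Y`. Both possible sums are fixed by `H`, so a failure of `G X ⊆ G Y` would put `q` in `X
+ H Z` but not in `Y + H Z`. -/
theorem mono (h : IsAnchoredAut G H) {d : ℕ} {X Y : Finset ℕ} (hX : X ∈ AnchoredSets d)
    (hY : Y ∈ AnchoredSets d) (hXY : X ⊆ Y) : G X ⊆ G Y := by
  have hq : 2 * d < 2 * d + 1 := by omega
  set q := 2 * d + 1 with hqdef
  have hGX := h.mapsTo hX
  have hGY := h.mapsTo hY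
  have hZ := punctured_mem_anchoredSets hq hGY
  set Z := punctured q d (G Y)
  have hle : ∀ {W z}, W ∈ AnchoredSets d → z ∈ W + Z → z ≤ 2 * q := fun hW hz => by
    have := (add_mem_anchoredSets hW hZ).2.2 _ hz
    omega
  by_contra hcon
  have hfull : G X + Z = Finset.range (2 * q + 1) := by
    ext z
    rw [Finset.mem_range, Nat.lt_succ_iff]
    refine ⟨hle hGX, fun hz => ?_⟩
    by_cases hzq : z = q
    · rw [hzq]
      exact (mem_add_punctured_self hq hGX).2 hcon
    · exact mem_add_punctured hq hGX hGY hz hzq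
  have herase : G Y + Z = (Finset.range (2 * q + 1)).erase q := by
    ext z
    rw [Finset.mem_erase, Finset.mem_range, Nat.lt_succ_iff]
    refine ⟨fun hz => ⟨?_, hle hGY hz⟩, fun hz => mem_add_punctured hq hGY hGY hz.2 hz.1⟩
    rintro rfl
    exact (mem_add_punctured_self hq hGY).1 hz subset_rfl
  have h1 : X + H Z = Finset.range (2 * q + 1) := by
    rw [← h.symm.map_range, ← hfull, h.symm.map_add hGX hZ, h.left_inv hX]
  have h2 : Y + H Z = (Finset.range (2 * q + 1)).erase q := by
    rw [← h.symm.map_erase (by omega), ← herase, h.symm.map_add hGY hZ, h.left_inv hY]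
  have hmem : q ∈ Y + H Z :=
    Finset.add_subset_add_right hXY (h1 ▸ Finset.mem_range.2 (by omega))
  simp [h2] at hmem

/-- The triple lies in the fixed set `{0, a} + {0, d - a} = {0, a, d - a, d}`, so by monotonicity
its image does too. Injectivity rules out the fixed sets `{0, d}` and the whole sum, unless the
triple equals one of them. -/
theorem map_triple (h : IsAnchoredAut G H) {a d : ℕ} (had : a ≤ d) :
    G {0, a, d} = {0, a, d} ∨ G {0, a, d} = {0, d - a, d} := by
  have hT := triple_mem_anchoredSets had
  have hQ : ({0, a} + {0, d - a} : Finset ℕ) ∈ AnchoredSets d := by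
    have := add_mem_anchoredSets (pair_mem_anchoredSets a) (pair_mem_anchoredSets (d - a))
    rwa [Nat.add_sub_cancel' had] at this
  have hQmem : ∀ z, z ∈ ({0, a} + {0, d - a} : Finset ℕ) ↔
      z = 0 ∨ z = a ∨ z = d - a ∨ z = d := by
    intro z
    rw [mem_pair_add]
    simp only [Finset.mem_insert, Finset.mem_singleton, exists_eq_or_imp, exists_eq_left]
    omega
  have hGQ : G ({0, a} + {0, d - a}) = {0, a} + {0, d - a} := by
    rw [h.map_add (pair_mem_anchoredSets a) (pair_mem_anchoredSets (d - a)), h.map_pair,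
      h.map_pair]
  have hsub : G {0, a, d} ⊆ {0, a} + {0, d - a} := by
    rw [← hGQ]
    refine h.mono hT hQ fun z hz => ?_
    rw [hQmem]
    simp only [Finset.mem_insert, Finset.mem_singleton] at hz
    omega
  have hsub' : ∀ z ∈ G {0, a, d}, z = 0 ∨ z = a ∨ z = d - a ∨ z = d := fun z hz =>
    (hQmem z).1 (hsub hz)
  obtain ⟨h0, hd, -⟩ := h.mapsTo hT
  by_cases ha : a ∈ G {0, a, d}
  · left
    by_cases hb : d - a ∈ G {0, a, d}
    · have hG : G {0, a, d} = {0, a} + {0, d - a} := by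
        refine hsub.antisymm fun z hz => ?_
        rcases (hQmem z).1 hz with rfl | rfl | rfl | rfl <;> assumption
      rw [hG]
      exact (h.inj hT hQ (hG.trans hGQ.symm)).symm
    · ext z
      simp only [Finset.mem_insert, Finset.mem_singleton]
      constructor
      · intro hz
        rcases hsub' z hz with rfl | rfl | rfl | rfl <;> simp_all
      · rintro (rfl | rfl | rfl) <;> assumption
  · by_cases hb : d - a ∈ G {0, a, d}
    · right
      ext z
      simp only [Finset.mem_insert, Finset.mem_singleton]
      constructor
      · intro hz
        rcases hsub' z hz with rfl | rfl | rfl | rfl <;> simp_all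
      · rintro (rfl | rfl | rfl) <;> assumption
    · left
      have hG : G {0, a, d} = {0, d} := by
        ext z
        simp only [Finset.mem_insert, Finset.mem_singleton]
        constructor
        · intro hz
          rcases hsub' z hz with rfl | rfl | rfl | rfl <;> simp_all
        · rintro (rfl | rfl) <;> assumption
      rw [hG]
      exact (h.inj hT (pair_mem_anchoredSets d) (hG.trans (h.map_pair d).symm)).symm

theorem map_subset_iff (h : IsAnchoredAut G H) {d : ℕ} {X Y : Finset ℕ}
    (hX : X ∈ AnchoredSets d) (hY : Y ∈ AnchoredSets d) : G X ⊆ G Y ↔ X ⊆ Y := by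
  refine ⟨fun hXY => ?_, h.mono hX hY⟩
  rw [← h.left_inv hX, ← h.left_inv hY]
  exact h.symm.mono (h.mapsTo hX) (h.mapsTo hY) hXY

theorem triple_subset_iff {a d : ℕ} {X : Finset ℕ} (hX : X ∈ AnchoredSets d) :
    ({0, a, d} : Finset ℕ) ⊆ X ↔ a ∈ X := by
  simp [Finset.insert_subset_iff, hX.1, hX.2.1]

theorem mem_map_iff (h : IsAnchoredAut G H) {a d : ℕ} {X : Finset ℕ} (had : a ≤ d)
    (hX : X ∈ AnchoredSets d) (hfix : G {0, a, d} = {0, a, d}) : a ∈ G X ↔ a ∈ X := by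
  rw [← triple_subset_iff (h.mapsTo hX), ← triple_subset_iff hX,
    ← h.map_subset_iff (triple_mem_anchoredSets had) hX, hfix]

theorem sub_mem_map_iff (h : IsAnchoredAut G H) {a d : ℕ} {X : Finset ℕ} (had : a ≤ d)
    (hX : X ∈ AnchoredSets d) (hfix : G {0, a, d} ≠ {0, a, d}) : d - a ∈ G X ↔ a ∈ X := by
  rw [← triple_subset_iff (h.mapsTo hX), ← triple_subset_iff hX,
    ← h.map_subset_iff (triple_mem_anchoredSets had) hX,
    (h.map_triple had).resolve_left hfix]

theorem map_triple_sub (h : IsAnchoredAut G H) {a d : ℕ} (had : a ≤ d)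
    (hfix : G {0, a, d} = {0, a, d}) : G {0, d - a, d} = {0, d - a, d} := by
  by_contra hne
  have h1 := (h.map_triple (Nat.sub_le d a)).resolve_left hne
  rw [Nat.sub_sub_self had] at h1
  have := h.inj (triple_mem_anchoredSets (Nat.sub_le d a)) (triple_mem_anchoredSets had)
    (h1.trans hfix.symm)
  rw [this] at hne
  exact hne hfix

theorem map_triple_add_pair (h : IsAnchoredAut G H) {a d : ℕ} (had : a ≤ d) (m : ℕ) :
    G ({0, a, d} + {0, m}) = G {0, a, d} + {0, m} := by
  rw [h.map_add (triple_mem_anchoredSets had) (pair_mem_anchoredSets m), h.map_pair]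

/-- The set `{0, 1, n} + {0, m}` is fixed and contains `1`, but not `n + m - 1`; the bounds on `n`
and `m` exclude the coincidences. -/
theorem map_triple_one_add (h : IsAnchoredAut G H) {n m : ℕ} (hn : 3 ≤ n) (hm : 2 ≤ m)
    (hfix : G {0, 1, n} = {0, 1, n}) : G {0, 1, n + m} = {0, 1, n + m} := by
  by_contra hne
  have hX := add_mem_anchoredSets (triple_mem_anchoredSets (show 1 ≤ n by omega))
    (pair_mem_anchoredSets m)
  have hmem := (h.sub_mem_map_iff (by omega) hX hne).2 (mem_triple_add_pair.2 (by omega))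
  rw [h.map_triple_add_pair (by omega), hfix, mem_triple_add_pair] at hmem
  omega

theorem map_triple_one (h : IsAnchoredAut G H) (h3 : G {0, 1, 3} = {0, 1, 3}) {n : ℕ}
    (hn : 3 ≤ n) : G {0, 1, n} = {0, 1, n} := by
  have hlarge : ∀ n, 5 ≤ n → G {0, 1, n} = {0, 1, n} := fun n hn => by
    have := h.map_triple_one_add le_rfl (show 2 ≤ n - 3 by omega) h3
    rwa [show 3 + (n - 3) = n by omega] at this
  rcases (by omega : n = 3 ∨ n = 4 ∨ 5 ≤ n) with rfl | rfl | hn'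
  · exact h3
  -- Reaching `4` from `3` would need `m = 1`, so `{0, 1, 4} + {0, 3}` is compared with the fixed
  -- triple `{0, 1, 7}` instead.
  · by_contra hne
    have hG := (h.map_triple (show 1 ≤ 4 by omega)).resolve_left hne
    have hX := add_mem_anchoredSets (triple_mem_anchoredSets (show 1 ≤ 4 by omega))
      (pair_mem_anchoredSets 3)
    have hmem := (h.mem_map_iff (by omega) hX (hlarge 7 (by omega))).2
      (mem_triple_add_pair.2 (by omega))
    rw [h.map_triple_add_pair (by omega), hG, mem_triple_add_pair] at hmem
    omega
  · exact hlarge n hn'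

theorem map_triple_of_ne (h : IsAnchoredAut G H) (h3 : G {0, 1, 3} = {0, 1, 3}) {b d : ℕ}
    (hb : 2 ≤ b) (hbd : b + 2 ≤ d) (hne : d + 1 ≠ 2 * b) : G {0, b, d} = {0, b, d} := by
  by_cases hd : d = 2 * b
  · have := h.map_triple (show b ≤ d by omega)
    rwa [show d - b = b by omega, or_self] at this
  obtain ⟨a, rfl⟩ : ∃ a, b = a + 1 := ⟨b - 1, by omega⟩
  obtain ⟨n, rfl⟩ : ∃ n, d = n + a := ⟨d - a, by omega⟩
  by_contra hcon
  -- The sum `{0, 1, n} + {0, a}` is fixed and contains `b = a + 1`. Its reflected point `d - b = n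
  -- - 1` lies in it only if `d = 2 * b` or `d + 1 = 2 * b`.
  have hX := add_mem_anchoredSets (triple_mem_anchoredSets (show 1 ≤ n by omega))
    (pair_mem_anchoredSets a)
  have hmem := (h.sub_mem_map_iff (by omega) hX hcon).2 (mem_triple_add_pair.2 (by omega))
  rw [h.map_triple_add_pair (by omega), h.map_triple_one h3 (by omega),
    mem_triple_add_pair] at hmem
  omega

theorem map_triple_eq_self (h : IsAnchoredAut G H) (h3 : G {0, 1, 3} = {0, 1, 3}) {b d : ℕ}
    (hbd : b ≤ d) : G {0, b, d} = {0, b, d} := by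
  rcases (by omega : b = 0 ∨ b = d ∨ d = 2 ∧ b = 1 ∨ 3 ≤ d ∧ (b = 1 ∨ b = d - 1) ∨
    2 ≤ b ∧ b + 2 ≤ d) with rfl | rfl | ⟨rfl, rfl⟩ | ⟨hd, rfl | rfl⟩ | ⟨hb, hbd'⟩
  · simpa using h.map_pair d
  · simpa using h.map_pair b
  · simpa using h.map_triple (show 1 ≤ 2 by omega)
  · exact h.map_triple_one h3 hd
  · exact h.map_triple_sub (by omega) (h.map_triple_one h3 hd)
  · by_cases hne : d + 1 = 2 * b
    -- Adding `{0, 1}` turns `b, d` into `b + 1, d + 1`, which escapes the exceptional relation.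
    · by_contra hcon
      have hG := (h.map_triple hbd).resolve_left hcon
      have hX := add_mem_anchoredSets (triple_mem_anchoredSets hbd) (pair_mem_anchoredSets 1)
      have hmem := (h.mem_map_iff (by omega) hX (h.map_triple_of_ne h3 (b := b + 1)
        (d := d + 1) (by omega) (by omega) (by omega))).2 (mem_triple_add_pair.2 (by omega))
      rw [h.map_triple_add_pair hbd, hG, mem_triple_add_pair] at hmem
      omega
    · exact h.map_triple_of_ne h3 hb hbd' hne

theorem eq_self_of_map_triple (h : IsAnchoredAut G H) (h3 : G {0, 1, 3} = {0, 1, 3}) {d : ℕ}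
    {X : Finset ℕ} (hX : X ∈ AnchoredSets d) : G X = X := by
  ext z
  by_cases hz : z ≤ d
  · exact h.mem_map_iff hz hX (h.map_triple_eq_self h3 hz)
  · exact ⟨fun hz' => absurd ((h.mapsTo hX).2.2 z hz') hz, fun hz' => absurd (hX.2.2 z hz') hz⟩

end IsAnchoredAut

/-! ### Reflection of anchored sets and the dichotomy -/

/-- The reflection `x ↦ max X - x` of a finite set of natural numbers containing `0`. -/
def anchoredReflection (X : Finset ℕ) : Finset ℕ :=
  X.image fun x => X.sup id - x

theorem sup_of_mem_anchoredSets {d : ℕ} {X : Finset ℕ} (hX : X ∈ AnchoredSets d) :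
    X.sup id = d :=
  le_antisymm (Finset.sup_le hX.2.2) (Finset.le_sup (f := id) hX.2.1)

theorem anchoredReflection_eq {d : ℕ} {X : Finset ℕ} (hX : X ∈ AnchoredSets d) :
    anchoredReflection X = X.image fun x => d - x := by
  rw [anchoredReflection, sup_of_mem_anchoredSets hX]

theorem anchoredReflection_mem {d : ℕ} {X : Finset ℕ} (hX : X ∈ AnchoredSets d) :
    anchoredReflection X ∈ AnchoredSets d := by
  rw [anchoredReflection_eq hX]
  refine ⟨Finset.mem_image.2 ⟨d, hX.2.1, by simp⟩, Finset.mem_image.2 ⟨0, hX.1, by simp⟩, ?_⟩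
  intro x hx
  obtain ⟨y, -, rfl⟩ := Finset.mem_image.1 hx
  exact Nat.sub_le d y

theorem anchoredReflection_anchoredReflection {d : ℕ} {X : Finset ℕ}
    (hX : X ∈ AnchoredSets d) : anchoredReflection (anchoredReflection X) = X := by
  rw [anchoredReflection_eq (anchoredReflection_mem hX), anchoredReflection_eq hX,
    Finset.image_image]
  conv_rhs => rw [← Finset.image_id (s := X)]
  refine Finset.image_congr fun x hx => ?_
  have := hX.2.2 x hx
  simp only [Function.comp_apply, id]
  omega

theorem anchoredReflection_add {d e : ℕ} {X Y : Finset ℕ} (hX : X ∈ AnchoredSets d)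
    (hY : Y ∈ AnchoredSets e) :
    anchoredReflection (X + Y) = anchoredReflection X + anchoredReflection Y := by
  rw [anchoredReflection_eq (add_mem_anchoredSets hX hY), anchoredReflection_eq hX,
    anchoredReflection_eq hY]
  ext z
  simp only [Finset.mem_image, Finset.mem_add]
  constructor
  · rintro ⟨_, ⟨x, hx, y, hy, rfl⟩, rfl⟩
    have := hX.2.2 x hx
    have := hY.2.2 y hy
    exact ⟨_, ⟨x, hx, rfl⟩, _, ⟨y, hy, rfl⟩, by omega⟩
  · rintro ⟨_, ⟨x, hx, rfl⟩, _, ⟨y, hy, rfl⟩, rfl⟩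
    have := hX.2.2 x hx
    have := hY.2.2 y hy
    exact ⟨_, ⟨x, hx, y, hy, rfl⟩, by omega⟩

namespace IsAnchoredAut

variable {G H : Finset ℕ → Finset ℕ}

theorem comp_anchoredReflection (h : IsAnchoredAut G H) :
    IsAnchoredAut (fun X => G (anchoredReflection X)) (fun X => anchoredReflection (H X)) where
  mapsTo hX := h.mapsTo (anchoredReflection_mem hX)
  mapsTo_inv hX := anchoredReflection_mem (h.mapsTo_inv hX)
  left_inv hX := by
    simp only [h.left_inv (anchoredReflection_mem hX), anchoredReflection_anchoredReflection hX]
  right_inv hX := by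
    simp only [anchoredReflection_anchoredReflection (h.mapsTo_inv hX), h.right_inv hX]
  map_add hX hY := by
    simp only [anchoredReflection_add hX hY,
      h.map_add (anchoredReflection_mem hX) (anchoredReflection_mem hY)]

theorem eq_self_or_eq_reflection (h : IsAnchoredAut G H) :
    (∀ {d X}, X ∈ AnchoredSets d → G X = X) ∨
      ∀ {d X}, X ∈ AnchoredSets d → G X = anchoredReflection X := by
  by_cases h3 : G {0, 1, 3} = {0, 1, 3}
  · exact Or.inl fun hX => h.eq_self_of_map_triple h3 hX
  · right
    intro d X hX
    have h13 := triple_mem_anchoredSets (show 1 ≤ 3 by omega)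
    have h23 := triple_mem_anchoredSets (show 2 ≤ 3 by omega)
    have h2 : G {0, 2, 3} = {0, 1, 3} := by
      refine (h.map_triple (show 2 ≤ 3 by omega)).resolve_left fun hG => h3 ?_
      exact h.map_triple_sub (a := 2) (by omega) hG
    have hr : anchoredReflection {0, 1, 3} = {0, 2, 3} := by
      rw [anchoredReflection_eq h13]
      decide
    have := h.comp_anchoredReflection.eq_self_of_map_triple (by simp only [hr, h2])
      (anchoredReflection_mem hX)
    simpa only [anchoredReflection_anchoredReflection hX] using this

end IsAnchoredAut

theorem IsNumericalSemigroup.exists_conductor {S : AddSubsemigroup ℕ}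
    (hS : IsNumericalSemigroup S) : ∃ c, ∀ n, c ≤ n → n ∈ S := by
  obtain ⟨b, hb⟩ := hS.bddAbove
  refine ⟨b + 1, fun n hn => ?_⟩
  by_contra hnS
  have := hb hnS
  omega

theorem eq_add_mul_of_add_eq_add {u : ℕ → ℤ} (hu : ∀ n m, u n + u m = u (n + m) + u 0)
    (n : ℕ) : u n = u 0 + n * (u 1 - u 0) := by
  induction n with
  | zero => simp
  | succ n ih =>
    have := hu n 1
    push_cast
    linarith

theorem Finset.add_singleton_eq_image (X : Finset ℕ) (c : ℕ) :
    X + {c} = X.image fun x => x + c :=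
  Finset.image₂_singleton_right

theorem Finset.add_singleton_cancel {X Y : Finset ℕ} {c : ℕ} (h : X + {c} = Y + {c}) :
    X = Y := by
  rw [Finset.add_singleton_eq_image, Finset.add_singleton_eq_image] at h
  exact Finset.image_injective (add_left_injective c) h

/-! ### Automorphisms of `P(S)` fix singletons -/

namespace PowerSemigroup

variable {S : AddSubsemigroup ℕ}

@[ext]
theorem ext {X Y : PowerSemigroup S} (h : X.toFinset = Y.toFinset) : X = Y :=
  Subtype.ext h

theorem toFinset_add (X Y : PowerSemigroup S) :
    (X + Y).toFinset = X.toFinset + Y.toFinset := rfl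

theorem mem_of_mem_toFinset (X : PowerSemigroup S) {x : ℕ} (hx : x ∈ X.toFinset) : x ∈ S :=
  X.2.2 x hx

theorem min_mem (X : PowerSemigroup S) : X.min ∈ X.toFinset := Finset.min'_mem _ _

theorem max_mem (X : PowerSemigroup S) : X.max ∈ X.toFinset := Finset.max'_mem _ _

theorem min_le (X : PowerSemigroup S) {x : ℕ} (hx : x ∈ X.toFinset) : X.min ≤ x :=
  Finset.min'_le _ _ hx

theorem le_max (X : PowerSemigroup S) {x : ℕ} (hx : x ∈ X.toFinset) : x ≤ X.max :=
  Finset.le_max' _ _ hx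

theorem min_le_max (X : PowerSemigroup S) : X.min ≤ X.max := X.min_le X.max_mem

theorem min_eq {X : PowerSemigroup S} {a : ℕ} (ha : a ∈ X.toFinset)
    (h : ∀ x ∈ X.toFinset, a ≤ x) : X.min = a :=
  le_antisymm (X.min_le ha) (h _ X.min_mem)

theorem max_eq {X : PowerSemigroup S} {a : ℕ} (ha : a ∈ X.toFinset)
    (h : ∀ x ∈ X.toFinset, x ≤ a) : X.max = a :=
  le_antisymm (h _ X.max_mem) (X.le_max ha)

theorem min_add (X Y : PowerSemigroup S) : (X + Y).min = X.min + Y.min := by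
  refine min_eq (Finset.add_mem_add X.min_mem Y.min_mem) fun z hz => ?_
  obtain ⟨x, hx, y, hy, rfl⟩ := Finset.mem_add.1 hz
  exact add_le_add (X.min_le hx) (Y.min_le hy)

theorem max_add (X Y : PowerSemigroup S) : (X + Y).max = X.max + Y.max := by
  refine max_eq (Finset.add_mem_add X.max_mem Y.max_mem) fun z hz => ?_
  obtain ⟨x, hx, y, hy, rfl⟩ := Finset.mem_add.1 hz
  exact add_le_add (X.le_max hx) (Y.le_max hy)

/-- The singleton `{s}` as an element of `P(S)`. -/
def single (s : ℕ) (hs : s ∈ S) : PowerSemigroup S :=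
  ⟨{s}, Finset.singleton_nonempty s, by simpa using hs⟩

theorem toFinset_single (s : ℕ) (hs : s ∈ S) : (single s hs).toFinset = {s} := rfl

theorem min_single (s : ℕ) (hs : s ∈ S) : (single s hs).min = s := Finset.min'_singleton s

theorem max_single (s : ℕ) (hs : s ∈ S) : (single s hs).max = s := Finset.max'_singleton s

theorem single_add_single {s t : ℕ} (hs : s ∈ S) (ht : t ∈ S) :
    single s hs + single t ht = single (s + t) (S.add_mem hs ht) :=
  ext (Finset.singleton_add_singleton s t)

theorem add_single_cancel {X Y : PowerSemigroup S} {s : ℕ} {hs : s ∈ S}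
    (h : X + single s hs = Y + single s hs) : X = Y :=
  ext (Finset.add_singleton_cancel (congrArg toFinset h))

theorem eq_single_of_min_eq_max {X : PowerSemigroup S} (h : X.min = X.max) :
    X = single X.min (X.mem_of_mem_toFinset X.min_mem) := by
  ext z
  rw [toFinset_single, Finset.mem_singleton]
  constructor
  · intro hz
    have := X.min_le hz
    have := X.le_max hz
    omega
  · rintro rfl
    exact X.min_mem

/-- If `X` has width `d > 0`, adding `X` does not distinguish `[c, c + 2d]` from the same interval
without its midpoint. -/
theorem min_eq_max_of_cancel {c : ℕ} (hc : ∀ n, c ≤ n → n ∈ S) {X : PowerSemigroup S}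
    (hX : ∀ A B, A + X = B + X → A = B) : X.min = X.max := by
  by_contra hne
  have hlt := lt_of_le_of_ne X.min_le_max hne
  obtain ⟨d, hd⟩ : ∃ d, X.max = X.min + d := ⟨X.max - X.min, by omega⟩
  have hI : ∀ x ∈ Finset.Icc c (c + 2 * d), x ∈ S := fun x hx => hc x (Finset.mem_Icc.1 hx).1
  let A : PowerSemigroup S := ⟨Finset.Icc c (c + 2 * d), ⟨c, by simp⟩, hI⟩
  let B : PowerSemigroup S := ⟨(Finset.Icc c (c + 2 * d)).erase (c + d),
    ⟨c, by simp; omega⟩, fun x hx => hI x (Finset.mem_of_mem_erase hx)⟩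
  have hmemA : ∀ z, z ∈ A.toFinset ↔ c ≤ z ∧ z ≤ c + 2 * d := fun z => Finset.mem_Icc
  have hmemB : ∀ z, z ∈ B.toFinset ↔ z ≠ c + d ∧ c ≤ z ∧ z ≤ c + 2 * d := fun z => by
    rw [← Finset.mem_Icc]
    exact Finset.mem_erase
  have hAB : A = B := by
    refine hX A B (ext ?_)
    simp only [toFinset_add]
    refine subset_antisymm (fun z hz => ?_) (Finset.add_subset_add_right
      (Finset.erase_subset _ _))
    obtain ⟨a, ha, x, hx, rfl⟩ := Finset.mem_add.1 hz
    rw [hmemA] at ha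
    have h1 := X.min_le hx
    have h2 := X.le_max hx
    by_cases had : a = c + d
    · by_cases hxm : x = X.min
      · exact Finset.mem_add.2 ⟨c, (hmemB _).2 (by omega), X.max, X.max_mem, by omega⟩
      · exact Finset.mem_add.2 ⟨x - X.min + a, (hmemB _).2 (by omega), X.min, X.min_mem,
          by omega⟩
    · exact Finset.add_mem_add ((hmemB _).2 ⟨had, ha⟩) hx
  have := (hmemA (c + d)).2 (by omega)
  rw [hAB, hmemB] at this
  exact this.1 rfl

theorem exists_map_single {c : ℕ} (hc : ∀ n, c ≤ n → n ∈ S) (f : AddAut (PowerSemigroup S))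
    (s : ℕ) (hs : s ∈ S) : ∃ t, ∃ ht : t ∈ S, f (single s hs) = single t ht := by
  refine ⟨_, _, eq_single_of_min_eq_max (min_eq_max_of_cancel hc fun A B h => ?_)⟩
  apply f.symm.injective
  apply add_single_cancel (s := s) (hs := hs)
  apply f.injective
  simpa using h

theorem exists_min_map_single {c : ℕ} (hc : ∀ n, c ≤ n → n ∈ S)
    (f : AddAut (PowerSemigroup S)) :
    ∃ r : ℤ, ∀ s (hs : s ∈ S), ((f (single s hs)).min : ℤ) = s * r := by
  have hadd : ∀ s t (hs : s ∈ S) (ht : t ∈ S), ((f (single s hs)).min : ℤ)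
      + (f (single t ht)).min = (f (single (s + t) (S.add_mem hs ht))).min := by
    intro s t hs ht
    rw [← single_add_single hs ht, map_add, min_add, Nat.cast_add]
  -- The offset `c` makes `u` defined on all of `ℕ`, at the price of being affine rather than
  -- additive; `u 0 + u 0 = u c` then fixes the constant term.
  let u : ℕ → ℤ := fun n => (f (single (c + n) (hc _ (Nat.le_add_right c n)))).min
  have hu : ∀ n m, u n + u m = u (n + m) + u 0 := by
    intro n m
    simp only [u, hadd]
    congr 4
    omega
  have hlin := eq_add_mul_of_add_eq_add hu
  have hu0 : u 0 + u 0 = u c := by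
    simp only [u, hadd]
    rfl
  refine ⟨u 1 - u 0, fun s hs => ?_⟩
  have hs0 : ((f (single s hs)).min : ℤ) + u 0 = u s := by
    simp only [u, hadd]
    congr 4
    omega
  have := hlin s
  linarith

theorem map_single {c : ℕ} (hc : ∀ n, c ≤ n → n ∈ S) (f : AddAut (PowerSemigroup S))
    (s : ℕ) (hs : s ∈ S) : f (single s hs) = single s hs := by
  obtain ⟨r, hr⟩ := exists_min_map_single hc f
  obtain ⟨r', hr'⟩ := exists_min_map_single hc f.symm
  have hr1 : r = 1 := by
    obtain ⟨t, ht, hft⟩ := exists_map_single hc f (c + 1) (hc _ (Nat.le_succ c))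
    have h1 := hr (c + 1) (hc _ (Nat.le_succ c))
    have h2 := hr' t ht
    rw [← hft, AddEquiv.symm_apply_apply, min_single] at h2
    rw [hft, min_single] at h1
    have hpos : (0 : ℤ) < ((c + 1 : ℕ) : ℤ) := by positivity
    have hrr : r * r' = 1 := by
      have : ((c + 1 : ℕ) : ℤ) * (r * r') = ((c + 1 : ℕ) : ℤ) * 1 := by
        rw [mul_one, ← mul_assoc, ← h1, ← h2]
      exact mul_left_cancel₀ hpos.ne' this
    have hr0 : 0 ≤ r := by
      have : (0 : ℤ) ≤ ((c + 1 : ℕ) : ℤ) * r := h1 ▸ Int.natCast_nonneg t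
      exact nonneg_of_mul_nonneg_right this hpos
    rcases Int.eq_one_or_neg_one_of_mul_eq_one hrr with h | h <;> omega
  obtain ⟨t, ht, hft⟩ := exists_map_single hc f s hs
  have h1 := hr s hs
  rw [hft, min_single, hr1, mul_one, Nat.cast_inj] at h1
  subst h1
  exact hft

/-! ### Minima and maxima are preserved -/

/-- The interval `[c, c + n]` as an element of `P(S)`. -/
def interval {c : ℕ} (hc : ∀ n, c ≤ n → n ∈ S) (n : ℕ) : PowerSemigroup S :=
  ⟨Finset.Icc c (c + n), ⟨c, by simp⟩, fun x hx => hc x (Finset.mem_Icc.1 hx).1⟩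

variable {c : ℕ} (hc : ∀ n, c ≤ n → n ∈ S)

theorem mem_interval {n x : ℕ} : x ∈ (interval hc n).toFinset ↔ c ≤ x ∧ x ≤ c + n :=
  Finset.mem_Icc

theorem min_interval (n : ℕ) : (interval hc n).min = c :=
  min_eq ((mem_interval hc).2 (by omega)) fun _ hx => ((mem_interval hc).1 hx).1

theorem max_interval (n : ℕ) : (interval hc n).max = c + n :=
  max_eq ((mem_interval hc).2 (by omega)) fun _ hx => ((mem_interval hc).1 hx).2

/-- The translates of the interval by the two ends of `X` already cover the sum, so only the minimum
and width of `X` matter. -/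
theorem add_interval (X : PowerSemigroup S) {n : ℕ} (hn : X.max - X.min ≤ n) :
    X + interval hc n = interval hc (n + (X.max - X.min))
      + single X.min (X.mem_of_mem_toFinset X.min_mem) := by
  have h := X.min_le_max
  ext z
  simp only [toFinset_add, Finset.mem_add, mem_interval, toFinset_single, Finset.mem_singleton,
    exists_eq_left]
  constructor
  · rintro ⟨x, hx, y, hy, rfl⟩
    have := X.min_le hx
    have := X.le_max hx
    exact ⟨x + y - X.min, by omega, by omega⟩
  · rintro ⟨y, hy, rfl⟩
    by_cases hyn : y ≤ c + n
    · exact ⟨X.min, X.min_mem, y, by omega, by omega⟩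
    · exact ⟨X.max, X.max_mem, y + X.min - X.max, by omega, by omega⟩

theorem interval_add_interval (n m : ℕ) :
    interval hc n + interval hc m = interval hc (n + m) + interval hc 0 := by
  ext z
  simp only [toFinset_add, Finset.mem_add, mem_interval]
  constructor
  · rintro ⟨x, hx, y, hy, rfl⟩
    exact ⟨x + y - c, by omega, c, by omega, by omega⟩
  · rintro ⟨x, hx, y, hy, rfl⟩
    by_cases hxn : x ≤ c + n
    · exact ⟨x, by omega, y, by omega, by omega⟩
    · exact ⟨c + n, by omega, x + y - (c + n), by omega, by omega⟩

include hc in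
theorem exists_min_max_map (f : AddAut (PowerSemigroup S)) :
    ∃ δ ε : ℤ, ∀ X, ((f X).min : ℤ) = X.min + (X.max - X.min : ℤ) * δ ∧
      ((f X).max : ℤ) = X.min + (X.max - X.min : ℤ) * ε := by
  let u : ℕ → ℤ := fun n => (f (interval hc n)).min
  let v : ℕ → ℤ := fun n => (f (interval hc n)).max
  have hu := eq_add_mul_of_add_eq_add (u := u) fun n m => by
    simp only [u, ← Nat.cast_add, ← min_add, ← map_add, interval_add_interval hc n m]
  have hv := eq_add_mul_of_add_eq_add (u := v) fun n m => by
    simp only [v, ← Nat.cast_add, ← max_add, ← map_add, interval_add_interval hc n m]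
  refine ⟨u 1 - u 0, v 1 - v 0, fun X => ?_⟩
  have hX := X.min_le_max
  obtain ⟨d, hd⟩ : ∃ d, X.max = X.min + d := ⟨X.max - X.min, by omega⟩
  have key := congrArg f (add_interval hc X le_rfl)
  rw [map_add, map_add, map_single hc, hd, Nat.add_sub_cancel_left] at key
  have h1 : ((f X).min : ℤ) + u d = u (d + d) + X.min := by
    have := congrArg min key
    rw [min_add, min_add, min_single] at this
    simp only [u]
    exact_mod_cast this
  have h2 : ((f X).max : ℤ) + v d = v (d + d) + X.min := by
    have := congrArg max key
    rw [max_add, max_add, max_single] at this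
    simp only [v]
    exact_mod_cast this
  rw [hu d, hu (d + d)] at h1
  rw [hv d, hv (d + d)] at h2
  rw [hd]
  push_cast at h1 h2 ⊢
  constructor <;> linarith

include hc in
theorem min_map_and_max_map (f : AddAut (PowerSemigroup S)) (X : PowerSemigroup S) :
    (f X).min = X.min ∧ (f X).max = X.max := by
  have nonneg : ∀ (g : AddAut (PowerSemigroup S)) (δ : ℤ), (∀ X, ((g X).min : ℤ)
      = X.min + (X.max - X.min : ℤ) * δ) → 0 ≤ δ := by
    intro g δ h
    -- The width `c + 1` exceeds the minimum `c`, so a slope `δ ≤ -1` would give a negative minimum.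
    have h1 := h (interval hc (c + 1))
    rw [min_interval, max_interval] at h1
    have h2 : (0 : ℤ) ≤ ((g (interval hc (c + 1))).min : ℤ) := Int.natCast_nonneg _
    push_cast at h1
    by_contra! hδ
    nlinarith
  obtain ⟨δ, ε, h⟩ := exists_min_max_map hc f
  obtain ⟨δ', ε', h'⟩ := exists_min_max_map hc f.symm
  have hδ := nonneg f δ fun X => (h X).1
  have hδ' := nonneg f.symm δ' fun X => (h' X).1
  obtain ⟨h1, h2⟩ := h (interval hc 1)
  obtain ⟨h3, h4⟩ := h' (f (interval hc 1))
  have h5 : ((f (interval hc 1)).min : ℤ) ≤ (f (interval hc 1)).max := by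
    exact_mod_cast min_le_max _
  rw [AddEquiv.symm_apply_apply, min_interval] at h3
  rw [AddEquiv.symm_apply_apply, max_interval] at h4
  rw [min_interval, max_interval] at h1 h2
  push_cast at h1 h2 h3 h4
  have hD : (ε - δ) * (ε' - δ') = 1 := by
    rw [h1, h2] at h3 h4
    linear_combination h3 - h4
  have hD0 : 0 ≤ ε - δ := by linarith
  have hD1 : ε - δ = 1 := by
    rcases Int.eq_one_or_neg_one_of_mul_eq_one hD with h | h <;> omega
  -- As `f` keeps the width `1` here, applying `f.symm` gives `δ + δ' = 0` with both terms
  -- nonnegative.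
  have hδ0 : δ = 0 := by
    have : ((f (interval hc 1)).max : ℤ) - (f (interval hc 1)).min = 1 := by linarith
    rw [this] at h3
    linarith
  have hε : ε = 1 := by linarith
  obtain ⟨h6, h7⟩ := h X
  rw [hδ0] at h6
  rw [hε] at h7
  constructor <;> omega

/-! ### Descent to anchored sets -/

/-- The translate of `X` by `c`, an element of `P(S)`; the junk value for empty `X` is `{c}`. -/
def shift (X : Finset ℕ) : PowerSemigroup S :=
  ⟨if X.Nonempty then X + {c} else {c}, by
    split_ifs with h
    · refine ⟨h.add (Finset.singleton_nonempty c), fun x hx => ?_⟩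
      obtain ⟨y, -, z, hz, rfl⟩ := Finset.mem_add.1 hx
      rw [Finset.mem_singleton.1 hz]
      exact hc _ (Nat.le_add_left c y)
    · refine ⟨Finset.singleton_nonempty c, fun x hx => ?_⟩
      rw [Finset.mem_singleton.1 hx]
      exact hc c le_rfl⟩

theorem toFinset_shift {d : ℕ} {X : Finset ℕ} (hX : X ∈ AnchoredSets d) :
    (shift hc X).toFinset = X + {c} :=
  if_pos ⟨0, hX.1⟩

theorem mem_shift {d : ℕ} {X : Finset ℕ} (hX : X ∈ AnchoredSets d) {z : ℕ} :
    z ∈ (shift hc X).toFinset ↔ ∃ x ∈ X, x + c = z := by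
  rw [toFinset_shift hc hX, Finset.add_singleton_eq_image, Finset.mem_image]

theorem min_shift {d : ℕ} {X : Finset ℕ} (hX : X ∈ AnchoredSets d) : (shift hc X).min = c := by
  refine min_eq ((mem_shift hc hX).2 ⟨0, hX.1, by simp⟩) fun z hz => ?_
  obtain ⟨x, -, rfl⟩ := (mem_shift hc hX).1 hz
  exact Nat.le_add_left c x

theorem max_shift {d : ℕ} {X : Finset ℕ} (hX : X ∈ AnchoredSets d) :
    (shift hc X).max = d + c := by
  refine max_eq ((mem_shift hc hX).2 ⟨d, hX.2.1, rfl⟩) fun z hz => ?_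
  obtain ⟨x, hx, rfl⟩ := (mem_shift hc hX).1 hz
  exact Nat.add_le_add_right (hX.2.2 x hx) c

/-- The map on finite sets of natural numbers with minimum `0` induced by an automorphism of
`P(S)`. -/
def anchoredMap (f : AddAut (PowerSemigroup S)) (X : Finset ℕ) : Finset ℕ :=
  (f (shift hc X)).toFinset.image fun x => x - c

theorem anchoredMap_add_singleton (f : AddAut (PowerSemigroup S)) {d : ℕ} {X : Finset ℕ}
    (hX : X ∈ AnchoredSets d) : anchoredMap hc f X + {c} = (f (shift hc X)).toFinset := by
  rw [Finset.add_singleton_eq_image, anchoredMap, Finset.image_image]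
  conv_rhs => rw [← Finset.image_id (s := (f (shift hc X)).toFinset)]
  refine Finset.image_congr fun x hx => ?_
  have h1 := min_le _ hx
  rw [(min_map_and_max_map hc f _).1, min_shift hc hX] at h1
  simp only [Function.comp_apply, id]
  omega

theorem anchoredMap_mem (f : AddAut (PowerSemigroup S)) {d : ℕ} {X : Finset ℕ}
    (hX : X ∈ AnchoredSets d) : anchoredMap hc f X ∈ AnchoredSets d := by
  obtain ⟨h1, h2⟩ := min_map_and_max_map hc f (shift hc X)
  rw [min_shift hc hX] at h1
  rw [max_shift hc hX] at h2
  refine ⟨Finset.mem_image.2 ⟨_, min_mem _, by omega⟩,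
    Finset.mem_image.2 ⟨_, max_mem _, by omega⟩, fun z hz => ?_⟩
  obtain ⟨x, hx, rfl⟩ := Finset.mem_image.1 hz
  have := le_max _ hx
  omega

theorem shift_anchoredMap (f : AddAut (PowerSemigroup S)) {d : ℕ} {X : Finset ℕ}
    (hX : X ∈ AnchoredSets d) : shift hc (anchoredMap hc f X) = f (shift hc X) :=
  ext (by rw [toFinset_shift hc (anchoredMap_mem hc f hX), anchoredMap_add_singleton hc f hX])

theorem anchoredMap_symm_anchoredMap (f : AddAut (PowerSemigroup S)) {d : ℕ} {X : Finset ℕ}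
    (hX : X ∈ AnchoredSets d) : anchoredMap hc f.symm (anchoredMap hc f X) = X := by
  apply Finset.add_singleton_cancel (c := c)
  rw [anchoredMap_add_singleton hc f.symm (anchoredMap_mem hc f hX), shift_anchoredMap hc f hX,
    AddEquiv.symm_apply_apply, toFinset_shift hc hX]

theorem isAnchoredAut_anchoredMap (f : AddAut (PowerSemigroup S)) :
    IsAnchoredAut (anchoredMap hc f) (anchoredMap hc f.symm) where
  mapsTo := anchoredMap_mem hc f
  mapsTo_inv := anchoredMap_mem hc f.symm
  left_inv := anchoredMap_symm_anchoredMap hc f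
  right_inv := anchoredMap_symm_anchoredMap hc f.symm
  map_add {d e X Y} hX hY := by
    have hXY := add_mem_anchoredSets hX hY
    -- The extra `{c}` balances the two shifts on the right; it is fixed by `f` and can be
    -- cancelled.
    have key : shift hc (X + Y) + single c (hc c le_rfl) = shift hc X + shift hc Y := by
      ext1
      rw [toFinset_add, toFinset_add, toFinset_shift hc hXY, toFinset_shift hc hX,
        toFinset_shift hc hY, toFinset_single]
      abel
    have := congrArg (fun Z => (f Z).toFinset) key
    simp only [_root_.map_add, map_single hc, toFinset_add, toFinset_single] at this
    rw [← anchoredMap_add_singleton hc f hXY, ← anchoredMap_add_singleton hc f hX,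
      ← anchoredMap_add_singleton hc f hY] at this
    apply Finset.add_singleton_cancel (c := c)
    apply Finset.add_singleton_cancel (c := c)
    rw [this]
    abel

/-- The translate of `X` with minimum `0`. -/
def anchor (X : PowerSemigroup S) : Finset ℕ :=
  X.toFinset.image fun x => x - X.min

theorem anchor_mem (X : PowerSemigroup S) : X.anchor ∈ AnchoredSets (X.max - X.min) := by
  refine ⟨Finset.mem_image.2 ⟨_, X.min_mem, by simp⟩,
    Finset.mem_image.2 ⟨_, X.max_mem, rfl⟩, fun z hz => ?_⟩
  obtain ⟨x, hx, rfl⟩ := Finset.mem_image.1 hz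
  exact Nat.sub_le_sub_right (X.le_max hx) _

theorem anchor_add_min (X : PowerSemigroup S) : X.anchor + {X.min} = X.toFinset := by
  rw [Finset.add_singleton_eq_image, anchor, Finset.image_image]
  conv_rhs => rw [← Finset.image_id (s := X.toFinset)]
  refine Finset.image_congr fun x hx => ?_
  have := X.min_le hx
  simp only [Function.comp_apply, id]
  omega

theorem anchoredReflection_anchor_add_min (X : PowerSemigroup S) :
    anchoredReflection X.anchor + {X.min} = X.reflection := by
  rw [anchoredReflection_eq X.anchor_mem, Finset.add_singleton_eq_image, anchor, Finset.image_image,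
    Finset.image_image, reflection]
  refine Finset.image_congr fun x hx => ?_
  have := X.min_le hx
  have := X.le_max hx
  simp only [Function.comp_apply]
  omega

/-- The anchor of `X` need not lie in `S`, so `X` is compared with its shifted anchor after adding
the fixed singleton `{c}`. -/
theorem toFinset_map (f : AddAut (PowerSemigroup S)) (X : PowerSemigroup S) :
    (f X).toFinset = anchoredMap hc f X.anchor + {X.min} := by
  have hX := X.anchor_mem
  have key : X + single c (hc c le_rfl)
      = shift hc X.anchor + single X.min (X.mem_of_mem_toFinset X.min_mem) := by
    ext1
    rw [toFinset_add, toFinset_add, toFinset_shift hc hX, toFinset_single, toFinset_single,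
      ← X.anchor_add_min]
    abel
  have := congrArg (fun Z => (f Z).toFinset) key
  simp only [_root_.map_add, map_single hc, toFinset_add, toFinset_single] at this
  rw [← anchoredMap_add_singleton hc f hX] at this
  apply Finset.add_singleton_cancel (c := c)
  rw [this]
  abel

theorem eq_refl_or_toFinset_eq_reflection (hS : IsNumericalSemigroup S)
    (f : AddAut (PowerSemigroup S)) :
    f = AddEquiv.refl _ ∨ ∀ X, (f X).toFinset = X.reflection := by
  obtain ⟨c, hc⟩ := hS.exists_conductor
  rcases (isAnchoredAut_anchoredMap hc f).eq_self_or_eq_reflection with h | h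
  · left
    ext X
    rw [toFinset_map hc, h X.anchor_mem, anchor_add_min]
    rfl
  · right
    intro X
    rw [toFinset_map hc, h X.anchor_mem, anchoredReflection_anchor_add_min]

/-! ### The reflection on `P(S)` -/

theorem mem_reflection {X : PowerSemigroup S} {z : ℕ} :
    z ∈ X.reflection ↔ ∃ x ∈ X.toFinset, X.max - x + X.min = z :=
  Finset.mem_image

/-- The reflection of `X` as an element of `P(S)`, where `S` contains all integers above any of
its elements. -/
def reflect (hS : ∀ s ∈ S, ∀ t, s ≤ t → t ∈ S) (X : PowerSemigroup S) : PowerSemigroup S :=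
  ⟨X.reflection, ⟨_, mem_reflection.2 ⟨_, X.min_mem, rfl⟩⟩, fun z hz => by
    obtain ⟨x, -, rfl⟩ := mem_reflection.1 hz
    exact hS _ (X.mem_of_mem_toFinset X.min_mem) _ (Nat.le_add_left _ _)⟩

theorem mem_reflect (hS : ∀ s ∈ S, ∀ t, s ≤ t → t ∈ S) {X : PowerSemigroup S} {z : ℕ} :
    z ∈ (reflect hS X).toFinset ↔ ∃ x ∈ X.toFinset, X.max - x + X.min = z :=
  mem_reflection

theorem min_reflect (hS : ∀ s ∈ S, ∀ t, s ≤ t → t ∈ S) (X : PowerSemigroup S) :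
    (reflect hS X).min = X.min := by
  refine min_eq ((mem_reflect hS).2 ⟨_, X.max_mem, by simp⟩) fun z hz => ?_
  obtain ⟨x, -, rfl⟩ := (mem_reflect hS).1 hz
  exact Nat.le_add_left _ _

theorem max_reflect (hS : ∀ s ∈ S, ∀ t, s ≤ t → t ∈ S) (X : PowerSemigroup S) :
    (reflect hS X).max = X.max := by
  have := X.min_le_max
  refine max_eq ((mem_reflect hS).2 ⟨_, X.min_mem, by omega⟩) fun z hz => ?_
  obtain ⟨x, hx, rfl⟩ := (mem_reflect hS).1 hz
  have := X.min_le hx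
  have := X.le_max hx
  omega

theorem reflect_reflect (hS : ∀ s ∈ S, ∀ t, s ≤ t → t ∈ S) (X : PowerSemigroup S) :
    reflect hS (reflect hS X) = X := by
  ext z
  simp only [mem_reflect, min_reflect, max_reflect]
  constructor
  · rintro ⟨_, ⟨x, hx, rfl⟩, rfl⟩
    have := X.min_le hx
    have := X.le_max hx
    rwa [show X.max - (X.max - x + X.min) + X.min = x by omega]
  · intro hz
    have := X.min_le hz
    have := X.le_max hz
    exact ⟨_, ⟨z, hz, rfl⟩, by omega⟩

theorem reflect_add (hS : ∀ s ∈ S, ∀ t, s ≤ t → t ∈ S) (X Y : PowerSemigroup S) :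
    reflect hS (X + Y) = reflect hS X + reflect hS Y := by
  ext z
  simp only [mem_reflect, min_add, max_add, toFinset_add, Finset.mem_add]
  constructor
  · rintro ⟨_, ⟨x, hx, y, hy, rfl⟩, rfl⟩
    have := X.le_max hx
    have := Y.le_max hy
    exact ⟨_, ⟨x, hx, rfl⟩, _, ⟨y, hy, rfl⟩, by omega⟩
  · rintro ⟨_, ⟨x, hx, rfl⟩, _, ⟨y, hy, rfl⟩, rfl⟩
    have := X.le_max hx
    have := Y.le_max hy
    exact ⟨_, ⟨x, hx, y, hy, rfl⟩, by omega⟩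

/-- The reflection automorphism of `P(S)`, where `S` contains all integers above any of its
elements. -/
def reflectAut (hS : ∀ s ∈ S, ∀ t, s ≤ t → t ∈ S) : AddAut (PowerSemigroup S) where
  toFun := reflect hS
  invFun := reflect hS
  left_inv := reflect_reflect hS
  right_inv := reflect_reflect hS
  map_add' := reflect_add hS

theorem reflectAut_ne_refl (hS : ∀ s ∈ S, ∀ t, s ≤ t → t ∈ S) {k : ℕ} (hk : k ∈ S) :
    reflectAut hS ≠ AddEquiv.refl _ := by
  intro h
  -- An asymmetric set: its reflection contains `k + 2`.
  let X : PowerSemigroup S := ⟨{k, k + 1, k + 3}, ⟨k, by simp⟩, fun x hx => by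
    refine hS k hk x ?_
    simp only [Finset.mem_insert, Finset.mem_singleton] at hx
    omega⟩
  have hmem : ∀ z, z ∈ X.toFinset ↔ z = k ∨ z = k + 1 ∨ z = k + 3 := fun z => by
    simp [X, toFinset]
  have hmin : X.min = k := min_eq ((hmem _).2 (by omega)) fun x hx => by
    have := (hmem x).1 hx
    omega
  have hmax : X.max = k + 3 := max_eq ((hmem _).2 (by omega)) fun x hx => by
    have := (hmem x).1 hx
    omega
  have h1 : k + 2 ∈ (reflect hS X).toFinset :=
    (mem_reflect hS).2 ⟨k + 1, (hmem _).2 (by omega), by omega⟩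
  have h2 : reflect hS X = X := DFunLike.congr_fun h X
  rw [h2, hmem] at h1
  omega

/-- If `s ∈ S` and `s < t`, then the reflection of some `X ∈ P(S)` contains `t`, even if `t ∉ S`. -/
theorem exists_mem_reflection (hS : IsNumericalSemigroup S) {s t : ℕ} (hs : s ∈ S)
    (hst : s < t) : ∃ X : PowerSemigroup S, t ∈ X.reflection := by
  obtain ⟨c, hc⟩ := hS.exists_conductor
  have h1 : c + s ∈ S := hc _ (by omega)
  have h2 : c + t ∈ S := hc _ (by omega)
  -- The middle point is reflected to `(c + t) - (c + s) + s = t`.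
  let X : PowerSemigroup S := ⟨{s, c + s, c + t}, ⟨s, by simp⟩, by simp [hs, h1, h2]⟩
  have hmem : ∀ z, z ∈ X.toFinset ↔ z = s ∨ z = c + s ∨ z = c + t := fun z => by
    simp [X, toFinset]
  have hmin : X.min = s := min_eq ((hmem _).2 (by omega)) fun x hx => by
    have := (hmem x).1 hx
    omega
  have hmax : X.max = c + t := max_eq ((hmem _).2 (by omega)) fun x hx => by
    have := (hmem x).1 hx
    omega
  exact ⟨X, mem_reflection.2 ⟨c + s, (hmem _).2 (by omega), by omega⟩⟩

end PowerSemigroup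

theorem theorem1p3 (S : AddSubsemigroup ℕ) (hS : IsNumericalSemigroup S) :
    (∀ k : ℕ, (S : Set ℕ) = Set.Ici k →
      ∃ σ : AddAut (PowerSemigroup S),
        (∀ X : PowerSemigroup S, (σ X).toFinset = X.reflection) ∧
        (∀ X : PowerSemigroup S, σ (σ X) = X) ∧
        σ ≠ AddEquiv.refl (PowerSemigroup S) ∧
        ∀ f : AddAut (PowerSemigroup S), f ≠ AddEquiv.refl (PowerSemigroup S) → f = σ) ∧
    ((¬ ∃ k : ℕ, (S : Set ℕ) = Set.Ici k) →
      ∀ f : AddAut (PowerSemigroup S), f = AddEquiv.refl (PowerSemigroup S)) := by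
  constructor
  · intro k hk
    have hmem : ∀ n, n ∈ S ↔ k ≤ n := fun n => by
      rw [← SetLike.mem_coe, hk, Set.mem_Ici]
    have hup : ∀ s ∈ S, ∀ t, s ≤ t → t ∈ S := fun s hs t hst =>
      (hmem t).2 (((hmem s).1 hs).trans hst)
    refine ⟨PowerSemigroup.reflectAut hup, fun _ => rfl, PowerSemigroup.reflect_reflect hup,
      PowerSemigroup.reflectAut_ne_refl hup ((hmem k).2 le_rfl), fun f hf => ?_⟩
    have h := (PowerSemigroup.eq_refl_or_toFinset_eq_reflection hS f).resolve_left hf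
    ext X
    rw [h X]
    rfl
  · intro hk f
    refine (PowerSemigroup.eq_refl_or_toFinset_eq_reflection hS f).resolve_right fun h => hk ?_
    obtain ⟨c, hc⟩ := hS.exists_conductor
    have hne : ∃ n, n ∈ S := ⟨c, hc c le_rfl⟩
    classical
    -- If `f` reflects, every `t` above the least element of `S` occurs in some image `f X`, hence
    -- lies in `S`.
    refine ⟨Nat.find hne, Set.ext fun t => ⟨fun ht => Nat.find_min' hne ht, fun ht => ?_⟩⟩
    rcases (Set.mem_Ici.1 ht).eq_or_lt with rfl | hlt
    · exact Nat.find_spec hne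
    · obtain ⟨X, hX⟩ := PowerSemigroup.exists_mem_reflection hS (Nat.find_spec hne) hlt
      rw [← h X] at hX
      exact (f X).mem_of_mem_toFinset hX
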